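/- Let $X,Y\subset\mathbb{R}^n$ be closed convex sets with $X\cap Y\neq\emptyset$, $\operatorname{aff}(X)=\operatorname{aff}(Y)$ and $\operatorname{ri}(X)\cap\operatorname{ri}(Y)\neq\emptyset$. Let $P_X,P_Y$ be the metric projections, $R_X=2P_X-\mathrm{Id}$, $R_Y=2P_Y-\mathrm{Id}$, $z_C=\tfrac12\bigl(P_YP_X(z)+P_XP_YP_X(z)\bigr)$, and $$T(z)=\operatorname{circ}\{z_C,\,R_X(z_C),\,R_Y(z_C)\},$$ where $\operatorname{circ}\{a,b,c\}$ is the point of $\operatorname{aff}\{a,b,c\}$ equidistant from $a,b,c$. Let $z^0\in\mathbb{R}^n$ be arbitrary and $z^{k+1}=T(z^k)$. Then $(z^k)$ converges to some $\bar z\in X\cap Y$, and there are $\omega\in(0,1)$ and a neighbourhood of $\bar z$ on which $$\omega\,\operatorname{dist}(z,X\cap Y)\le\max\{\operatorname{dist}(z,X),\operatorname{dist}(z,Y)\}.\qquad(\mathrm{EB})$$ Suppose moreover that the relative boundaries of $X$ and $Y$ are $\mathcal C^2$ manifolds of codimension one near $\bar z$ within the common affine hull, in the following sense. Let $V$ be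 the direction space of the affine hull. For each $C\in\{X,Y\}$ there are a neighbourhood $U$ of $\bar z$ in $\operatorname{aff}(C)$ and a $\mathcal C^2$ function $g_C:U\to\mathbb{R}$ such that $\{z\in U: g_C(z)=0\}$ is the part in $U$ of the relative boundary of $C$, $C\cap U=\{z\in U: g_C(z)\le 0\}$, and the gradient $\nabla g_C(\bar z)\in V$ of $g_C$ within $\operatorname{aff}(C)$ is nonzero. Put $$\kappa_C=\max\left\{\frac{|D^2g_C(\bar z)[v,v]|}{\|\nabla g_C(\bar z)\|}\;:\;v\in V,\ \langle\nabla g_C(\bar z),v\rangle=0,\ \|v\|=1\right\}$$ (with $\kappa_C=0$ if there is no such $v$); for $\bar z$ in the relative boundary of $C$ this is the curvature of that boundary at $\bar z$. Then $(z^k)$ converges Q-quadratically to $\bar z$, that is, $\limsup_{k\to\infty}\|z^{k+1}-\bar z\|/\|z^k-\bar z\|^2<\infty$. Moreover, for any such $g_X,g_Y$ and every $\omega\in(0,1)$ for which (EB) holds for all $z$ near $\bar z$, $$\limsup_{k\to\infty}\frac{\operatorname{dist}(z^{k+1},X\cap Y)}{\operatorname{dist}(z^k,X\cap Y)^2}\le\frac{4\max(\kappa_X,\kappa_Y)}{\omega}.$$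 Quotients are taken in $[0,\infty]$ with $0/0=0$ and $a/0=\infty$ for $a>0$. -/

import Mathlib

open Set Filter Topology

noncomputable section

namespace CCRM

/-- The coordinate space `ℝⁿ` with its Euclidean norm. -/
abbrev E (n : ℕ) := EuclideanSpace ℝ (Fin n)

/-! ### Projections, reflections, circumcenters, and the iteration map -/

open Classical in
/-- The metric projection `P_C`: the point of `C` nearest to `x`. It exists and is unique when `C`
is nonempty, closed and convex (`proj_mem`, `eq_proj`); the value `x` otherwise is a dummy. -/
def proj {n : ℕ} (C : Set (E n)) (x : E n) : E n :=
  if h : ∃ p ∈ C, dist x p = Metric.infDist x C then h.choose else x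

/-- The reflection `R_C = 2 P_C - Id`. -/
def refl {n : ℕ} (C : Set (E n)) (x : E n) : E n := (2 : ℝ) • proj C x - x

/-- `p` is the circumcenter of the triple `(a, b, c)` (points may coincide): it lies in the affine
hull of the three points and is equidistant from them. -/
def IsCircumcenter {n : ℕ} (p a b c : E n) : Prop :=
  p ∈ affineSpan ℝ ({a, b, c} : Set (E n)) ∧ dist p a = dist p b ∧ dist p a = dist p c

open Classical in
/-- The circumcenter of `(a, b, c)`; it is unique whenever it exists (`IsCircumcenter.unique`),
and the value `a` otherwise is a dummy. -/
def circum {n : ℕ} (a b c : E n) : E n :=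
  if h : ∃ p, IsCircumcenter p a b c then h.choose else a

/-- The centralized point `z_C = (P_Y P_X z + P_X P_Y P_X z) / 2`. -/
def centralize {n : ℕ} (X Y : Set (E n)) (z : E n) : E n :=
  (1 / 2 : ℝ) • (proj Y (proj X z) + proj X (proj Y (proj X z)))

/-- The map `T(z) = circum (z_C, R_X z_C, R_Y z_C)` of the centralized circumcentered-reflection
method. -/
def step {n : ℕ} (X Y : Set (E n)) (z : E n) : E n :=
  circum (centralize X Y z) (refl X (centralize X Y z)) (refl Y (centralize X Y z))

/-! ### Relative boundaries of class `C²` and their curvature -/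

/-- The direction subspace `V_C` of the affine hull of `C`. -/
abbrev dirSpace {n : ℕ} (C : Set (E n)) : Submodule ℝ (E n) := (affineSpan ℝ C).direction

/-- `g` represents the relative boundary of `C` near `zbar` as a `C²` manifold of codimension one
within the affine hull of `C`. The affine hull is parametrized by `v ↦ zbar + v`, `v ∈ V_C`, and `g`
is written as a function of `v`: on an open neighbourhood `U` of `zbar` (that is, of `v = 0`), `g` is
`C²`, vanishes exactly on the relative boundary, is `≤ 0` exactly on `C`, and its gradient within the
affine hull at `zbar` is nonzero (in particular `dim (aff C) ≥ 1`). -/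
def IsC2BoundaryFunction {n : ℕ} (C : Set (E n)) (zbar : E n) (g : dirSpace C → ℝ) : Prop :=
  zbar ∈ affineSpan ℝ C ∧
  (∃ U : Set (dirSpace C), IsOpen U ∧ 0 ∈ U ∧ ContDiffOn ℝ 2 g U ∧
    ∀ v ∈ U, (zbar + (v : E n) ∈ intrinsicFrontier ℝ C ↔ g v = 0) ∧
      (zbar + (v : E n) ∈ C ↔ g v ≤ 0)) ∧
  gradient g 0 ≠ 0

/-- The curvature `max { |D²g(zbar)[v,v]| / ‖∇g(zbar)‖ : v ∈ V_C, ⟪∇g(zbar), v⟫ = 0, ‖v‖ = 1 }` of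
the relative boundary of `C` at `zbar`, in terms of a function `g` representing it. (If the tangent
space is `{0}`, the maximum over the empty set is `0`.) -/
def curvature {n : ℕ} {C : Set (E n)} (g : dirSpace C → ℝ) : ℝ :=
  sSup ((fun v : dirSpace C => |fderiv ℝ (fderiv ℝ g) 0 v v| / ‖gradient g 0‖) ''
    {v | inner ℝ (gradient g 0) v = 0 ∧ ‖v‖ = 1})

/-! ### Error bound and rate of convergence -/

/-- The local error bound of the pair `X, Y` at `zbar` with constant `ω`. -/
def ErrorBound {n : ℕ} (X Y : Set (E n)) (zbar : E n) (ω : ℝ) : Prop :=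
  ω ∈ Ioo (0 : ℝ) 1 ∧
  ∀ᶠ w in 𝓝 zbar,
    ω * Metric.infDist w (X ∩ Y) ≤ max (Metric.infDist w X) (Metric.infDist w Y)

/-- Q-quadratic convergence of `z` to `zbar`:
`limsup ‖z (k+1) - zbar‖ / ‖z k - zbar‖ ^ 2 ≤ C < ∞`. The quotient is taken in `[0, ∞]`, where
`0 / 0 = 0` (termination at `zbar`) and `a / 0 = ∞` for `a > 0`. -/
def QQuadratic {n : ℕ} (z : ℕ → E n) (zbar : E n) : Prop :=
  Tendsto z atTop (𝓝 zbar) ∧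
  ∃ C : NNReal, limsup (fun k => edist (z (k + 1)) zbar / edist (z k) zbar ^ 2) atTop ≤ C

/-! ### Well-definedness of projections and circumcenters -/

theorem exists_nearest {n : ℕ} {C : Set (E n)} (hc : IsClosed C) (hne : C.Nonempty) (x : E n) :
    ∃ p ∈ C, dist x p = Metric.infDist x C := by
  obtain ⟨p, hp, h⟩ := hc.exists_infDist_eq_dist hne x
  exact ⟨p, hp, h.symm⟩

theorem proj_mem {n : ℕ} {C : Set (E n)} (hc : IsClosed C) (hne : C.Nonempty) (x : E n) :
    proj C x ∈ C ∧ dist x (proj C x) = Metric.infDist x C := by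
  have h := exists_nearest hc hne x
  unfold proj
  rw [dif_pos h]
  exact h.choose_spec

theorem eq_proj {n : ℕ} {C : Set (E n)} (hc : IsClosed C) (hv : Convex ℝ C) {x p : E n}
    (hp : p ∈ C) (h : dist x p = Metric.infDist x C) : p = proj C x := by
  obtain ⟨hq, h'⟩ := proj_mem hc ⟨p, hp⟩ x
  set q := proj C x
  by_contra hne
  have hm : (1 / 2 : ℝ) • p + (1 / 2 : ℝ) • q ∈ C := hv hp hq (by norm_num) (by norm_num) (by norm_num)
  have hle := Metric.infDist_le_dist_of_mem (x := x) hm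
  have e : x - ((1 / 2 : ℝ) • p + (1 / 2 : ℝ) • q) = (1 / 2 : ℝ) • ((x - p) + (x - q)) := by
    module
  rw [dist_eq_norm] at h h' hle
  rw [e, norm_smul] at hle
  have par := parallelogram_law_with_norm ℝ (x - p) (x - q)
  have e2 : (x - p) - (x - q) = q - p := by abel
  rw [e2, h, h'] at par
  have hpos : 0 < ‖q - p‖ := norm_pos_iff.2 (sub_ne_zero.2 (Ne.symm hne))
  have h0 : 0 ≤ Metric.infDist x C := Metric.infDist_nonneg
  have hh : ‖(1 / 2 : ℝ)‖ = 1 / 2 := by norm_num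
  rw [hh] at hle
  nlinarith [norm_nonneg ((x - p) + (x - q))]

theorem IsCircumcenter.unique {n : ℕ} {p q a b c : E n} (hp : IsCircumcenter p a b c)
    (hq : IsCircumcenter q a b c) : p = q := by
  obtain ⟨hp, hpb, hpc⟩ := hp
  obtain ⟨hq, hqb, hqc⟩ := hq
  have ha : a ∈ affineSpan ℝ ({a, b, c} : Set (E n)) := subset_affineSpan ℝ _ (by simp)
  have key : ∀ y, dist p a = dist p y → dist q a = dist q y → inner ℝ (p - q) (y - a) = 0 := by
    intro y h1 h2
    rw [dist_eq_norm, dist_eq_norm] at h1 h2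
    have h1' : ‖p - a‖ ^ 2 = ‖p - y‖ ^ 2 := by rw [h1]
    have h2' : ‖q - a‖ ^ 2 = ‖q - y‖ ^ 2 := by rw [h2]
    simp only [← real_inner_self_eq_norm_sq, inner_sub_left, inner_sub_right] at h1' h2' ⊢
    simp only [real_inner_comm] at h1' h2' ⊢
    have s1 := real_inner_comm a p
    have s2 := real_inner_comm y p
    have s3 := real_inner_comm a q
    have s4 := real_inner_comm y q
    linarith
  have hspan : ∀ w ∈ (affineSpan ℝ ({a, b, c} : Set (E n))).direction, inner ℝ (p - q) w = 0 := by
    intro w hw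
    rw [direction_affineSpan, vectorSpan_eq_span_vsub_set_right ℝ (show a ∈ ({a, b, c} : Set (E n)) by simp)]
      at hw
    induction hw using Submodule.span_induction with
    | mem x hx =>
      obtain ⟨y, hy, rfl⟩ := hx
      simp only [mem_insert_iff, mem_singleton_iff] at hy
      rcases hy with rfl | rfl | rfl
      · simp
      · exact key _ hpb hqb
      · exact key _ hpc hqc
    | zero => simp
    | add x y _ _ hx hy => rw [inner_add_right, hx, hy, add_zero]
    | smul t x _ hx => rw [inner_smul_right, hx, mul_zero]
  have := hspan (p - q) (AffineSubspace.vsub_mem_direction hp hq)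
  exact sub_eq_zero.1 (inner_self_eq_zero.1 this)

theorem IsCircumcenter.eq_circum {n : ℕ} {p a b c : E n} (hp : IsCircumcenter p a b c) :
    p = circum a b c := by
  have h : ∃ p, IsCircumcenter p a b c := ⟨p, hp⟩
  unfold circum
  rw [dif_pos h]
  exact hp.unique h.choose_spec

end CCRM

end

/-!
Let `S = X ∩ Y`, let `z` be the current iterate, `c` the centralized point and `w` the new iterate.

**One step.** The point `c` is half way between `y = P_Y P_X z` and its projection onto `X`, so the
displacements `c - P_X c` and `c - P_Y c` make an obtuse angle (`inner_centralize_le`). For such a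
point the circumcenter is the projection of `c` onto the intersection of the two half-spaces which
support `X` at `P_X c` and `Y` at `P_Y c`, and it lies on both bounding hyperplanes
(`exists_isCircumcenter`, `step_spec`). These half-spaces contain `S`, whence the Fejér inequality
`‖w - s‖² + ‖w - c‖² ≤ ‖c - s‖² ≤ ‖z - s‖²` for `s ∈ S`, and with it convergence
(`exists_tendsto_of_step`). The error bound follows by moving a point close to both sets slightly
towards a common relatively interior point (`exists_errorBound`).

**Quadratic rate.** If `C` is a sublevel set of a `C²` function near the limit, then a point `w` of a
half-space supporting `C` at `p` satisfies `dist (w, C) ≤ (κ_C / 2 + ε) ‖w - p‖²` as soon as `p` and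
`w` are close enough to the limit: `w - p` is not an ascent direction at `p`, whose gradient is
normal to the half-space (`fderiv_nonpos_of_normal`), so the first order term of the Taylor
expansion at `p` helps, and the second order term is governed by the curvature unless `w - p` is far
from tangent, in which case the first order term dominates (`eventually_sub_smul_gradient_nonpos`,
`IsC2BoundaryFunction.hasQuadraticSupport`). This applies to `X` at `P_X c` and to `Y` at `P_Y c`;
if `c ∈ Y`, so that `P_Y c = c` provides no half-space, it applies to `Y` at `y`. All these points
`p` are, like `w`, within `dist (z, S)` of the point of `S` nearest to `z`, so
`‖w - p‖ ≤ 2 dist (z, S)`, and the error bound gives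
`dist (w, S) ≤ (2 max κ + 4 ε) / ω * dist (z, S)²` (`eventually_infDist_step_le`). By Fejér
monotonicity `‖z k - zbar‖ ≤ 2 dist (z k, S)` (`norm_sub_le_two_mul_infDist`), which turns this into
quadratic convergence of the iterates themselves.
-/

namespace CCRM

/-! ### Metric projections -/

section Projection

variable {n : ℕ} {C : Set (E n)}

theorem inner_sub_proj_nonpos (hc : IsClosed C) (hv : Convex ℝ C) (x : E n) {s : E n}
    (hs : s ∈ C) : inner ℝ (x - proj C x) (s - proj C x) ≤ 0 := by
  obtain ⟨hp, hd⟩ := proj_mem hc ⟨s, hs⟩ x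
  refine (norm_eq_iInf_iff_real_inner_le_zero hv hp).1 ?_ s hs
  rw [← dist_eq_norm, hd, Metric.infDist_eq_iInf]
  simp only [dist_eq_norm]

theorem proj_eq_of_inner_nonpos (hc : IsClosed C) (hv : Convex ℝ C) {x p : E n} (hp : p ∈ C)
    (h : ∀ s ∈ C, inner ℝ (x - p) (s - p) ≤ 0) : proj C x = p := by
  refine (eq_proj hc hv hp ?_).symm
  have := (norm_eq_iInf_iff_real_inner_le_zero hv hp).2 h
  rw [dist_eq_norm, this, Metric.infDist_eq_iInf]
  simp only [dist_eq_norm]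

theorem norm_proj_sub_le (hc : IsClosed C) (hv : Convex ℝ C) (x : E n) {s : E n}
    (hs : s ∈ C) : ‖proj C x - s‖ ≤ ‖x - s‖ := by
  have h := inner_sub_proj_nonpos hc hv x hs
  set p := proj C x
  have e : x - s = (x - p) - (s - p) := by abel
  have h2 := norm_sub_sq_real (x - p) (s - p)
  rw [← e] at h2
  rw [norm_sub_rev p s]
  refine le_of_sq_le_sq ?_ (norm_nonneg _)
  nlinarith [sq_nonneg ‖x - p‖]

/-- The midpoint of `y` and its projection has the same projection as `y`. -/
theorem proj_midpoint (hc : IsClosed C) (hv : Convex ℝ C) (hne : C.Nonempty) (y : E n) :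
    proj C ((1 / 2 : ℝ) • (y + proj C y)) = proj C y := by
  refine proj_eq_of_inner_nonpos hc hv (proj_mem hc hne y).1 fun s hs => ?_
  have e : (1 / 2 : ℝ) • (y + proj C y) - proj C y = (1 / 2 : ℝ) • (y - proj C y) := by module
  rw [e, real_inner_smul_left]
  linarith [inner_sub_proj_nonpos hc hv y hs]

theorem infDist_le_norm_sub {p : E n} (hp : p ∈ C) (w : E n) : Metric.infDist w C ≤ ‖w - p‖ := by
  rw [← dist_eq_norm]
  exact Metric.infDist_le_dist_of_mem hp

end Projection

/-! ### Circumcenters of centralized triples -/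

/-- If the displacements `u`, `v` from `c` to its two projections make an obtuse angle and the two
half-spaces `{s | ⟪s - c, u⟫ ≤ -‖u‖²}`, `{s | ⟪s - c, v⟫ ≤ -‖v‖²}` have a common point, then the
circumcenter of `c` and its two reflections exists; it lies on both bounding hyperplanes and is
reached from `c` by a nonnegative combination of `-u` and `-v`, so it is the projection of `c` onto
the intersection of the half-spaces. -/
theorem exists_isCircumcenter {n : ℕ} (c u v s : E n) (huv : inner ℝ u v ≤ 0)
    (hu : inner ℝ (s - c) u ≤ -‖u‖ ^ 2) (hv : inner ℝ (s - c) v ≤ -‖v‖ ^ 2) :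
    ∃ (w : E n) (α β : ℝ), 0 ≤ α ∧ 0 ≤ β ∧ w = c - α • u - β • v ∧
      IsCircumcenter w c (c - (2 : ℝ) • u) (c - (2 : ℝ) • v) ∧
      inner ℝ (w - c) u = -‖u‖ ^ 2 ∧ inner ℝ (w - c) v = -‖v‖ ^ 2 ∧ (v = 0 → w = c - u) := by
  obtain ⟨α, β, hα, hβ, h1, h2, h3⟩ : ∃ α β : ℝ, 0 ≤ α ∧ 0 ≤ β ∧
      α * ‖u‖ ^ 2 + β * inner ℝ u v = ‖u‖ ^ 2 ∧ α * inner ℝ u v + β * ‖v‖ ^ 2 = ‖v‖ ^ 2 ∧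
      (v = 0 → α = 1) := by
    rcases eq_or_ne v 0 with rfl | hv0
    · exact ⟨1, 0, by norm_num, le_rfl, by simp, by simp, fun _ => rfl⟩
    rcases eq_or_ne u 0 with rfl | hu0
    · exact ⟨0, 1, le_rfl, by norm_num, by simp, by simp, fun h => absurd h hv0⟩
    have ha : 0 < ‖u‖ ^ 2 := by positivity
    have hb : 0 < ‖v‖ ^ 2 := by positivity
    set a := ‖u‖ ^ 2 with hadef
    set b := ‖v‖ ^ 2 with hbdef
    set m : ℝ := inner ℝ u v with hm
    have hD : 0 < a * b - m ^ 2 := by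
      have hn : ‖b • u - m • v‖ ^ 2 = b * (a * b - m ^ 2) := by
        rw [norm_sub_sq_real, norm_smul, norm_smul, real_inner_smul_left, real_inner_smul_right,
          mul_pow, mul_pow, Real.norm_eq_abs, Real.norm_eq_abs, sq_abs, sq_abs, ← hadef, ← hbdef,
          ← hm]
        ring
      rcases (sq_nonneg ‖b • u - m • v‖).lt_or_eq with h | h
      · rw [hn] at h
        exact pos_of_mul_pos_right h hb.le
      · -- antiparallel `u` and `v` would separate the two half-spaces
        have h0 : b • u - m • v = 0 := by
          rw [← norm_eq_zero]; exact pow_eq_zero_iff (two_ne_zero) |>.1 h.symm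
        have h4 : b * inner ℝ (s - c) u = m * inner ℝ (s - c) v := by
          rw [← real_inner_smul_right, ← real_inner_smul_right, sub_eq_zero.1 h0]
        nlinarith [mul_pos ha hb, mul_nonneg_of_nonpos_of_nonpos huv (hv.trans (by linarith) :
          inner ℝ (s - c) v ≤ 0)]
    refine ⟨b * (a - m) / (a * b - m ^ 2), a * (b - m) / (a * b - m ^ 2), ?_, ?_, ?_, ?_,
      fun h => absurd h hv0⟩
    · exact div_nonneg (mul_nonneg hb.le (by linarith)) hD.le
    · exact div_nonneg (mul_nonneg ha.le (by linarith)) hD.le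
    · rw [div_mul_eq_mul_div, div_mul_eq_mul_div, ← add_div, div_eq_iff hD.ne']; ring
    · rw [div_mul_eq_mul_div, div_mul_eq_mul_div, ← add_div, div_eq_iff hD.ne']; ring
  have e : c - α • u - β • v - c = -(α • u + β • v) := by abel
  have hiu : inner ℝ (c - α • u - β • v - c) u = -‖u‖ ^ 2 := by
    rw [e, inner_neg_left, inner_add_left, real_inner_smul_left, real_inner_smul_left,
      real_inner_self_eq_norm_sq, real_inner_comm u v, h1]
  have hiv : inner ℝ (c - α • u - β • v - c) v = -‖v‖ ^ 2 := by
    rw [e, inner_neg_left, inner_add_left, real_inner_smul_left, real_inner_smul_left,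
      real_inner_self_eq_norm_sq, h2]
  have equi : ∀ w t : E n, inner ℝ (w - c) t = -‖t‖ ^ 2 → dist w c = dist w (c - (2 : ℝ) • t) := by
    intro w t h
    rw [dist_eq_norm, dist_eq_norm, show w - (c - (2 : ℝ) • t) = (w - c) + (2 : ℝ) • t by abel,
      ← sq_eq_sq₀ (norm_nonneg _) (norm_nonneg _), norm_add_sq_real, real_inner_smul_right, h,
      norm_smul, Real.norm_ofNat]
    ring
  refine ⟨_, α, β, hα, hβ, rfl, ⟨?_, equi _ _ hiu, equi _ _ hiv⟩, hiu, hiv, ?_⟩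
  · have hc : c ∈ affineSpan ℝ ({c, c - (2 : ℝ) • u, c - (2 : ℝ) • v} : Set (E n)) :=
      subset_affineSpan ℝ _ (by simp)
    have hcu : c - (2 : ℝ) • u ∈ affineSpan ℝ ({c, c - (2 : ℝ) • u, c - (2 : ℝ) • v} : Set (E n)) :=
      subset_affineSpan ℝ _ (by simp)
    have hcv : c - (2 : ℝ) • v ∈ affineSpan ℝ ({c, c - (2 : ℝ) • u, c - (2 : ℝ) • v} : Set (E n)) :=
      subset_affineSpan ℝ _ (by simp)
    have hd := Submodule.add_mem _
      (Submodule.smul_mem _ (α / 2) (AffineSubspace.vsub_mem_direction hcu hc))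
      (Submodule.smul_mem _ (β / 2) (AffineSubspace.vsub_mem_direction hcv hc))
    have := AffineSubspace.vadd_mem_of_mem_direction hd hc
    convert this using 1
    simp only [vsub_eq_sub, vadd_eq_add]
    module
  · intro h
    rw [h3 h, h, smul_zero, one_smul, sub_zero]

/-! ### One step of the method -/

section Step

variable {n : ℕ} {X Y : Set (E n)}

theorem proj_centralize_left (hX : IsClosed X) (hXc : Convex ℝ X) (hne : X.Nonempty) (z : E n) :
    proj X (centralize X Y z) = proj X (proj Y (proj X z)) :=
  proj_midpoint hX hXc hne _

/-- The point `centralize X Y z` is centralized: its displacements to `X` and `Y` make an obtuse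
angle. The quantitative form also shows that such a point of `X` lies in `Y`. -/
theorem inner_centralize_le (hX : IsClosed X) (hXc : Convex ℝ X) (hY : IsClosed Y)
    (hYc : Convex ℝ Y) (hne : (X ∩ Y).Nonempty) (z : E n) :
    inner ℝ (centralize X Y z - proj X (centralize X Y z))
      (centralize X Y z - proj Y (centralize X Y z)) ≤
      -‖centralize X Y z - proj Y (centralize X Y z)‖ ^ 2 := by
  rw [proj_centralize_left hX hXc hne.left]
  have h := inner_sub_proj_nonpos hY hYc (centralize X Y z)
    (proj_mem hY hne.right (proj X z)).1
  set c := centralize X Y z with hc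
  set y := proj Y (proj X z) with hy
  have e : c - proj X y = y - c := by
    rw [hc, centralize, ← hy]; module
  rw [e, show y - c = (y - proj Y c) - (c - proj Y c) by abel, inner_sub_left,
    real_inner_self_eq_norm_sq, real_inner_comm]
  linarith

theorem norm_centralize_sub_le (hX : IsClosed X) (hXc : Convex ℝ X) (hY : IsClosed Y)
    (hYc : Convex ℝ Y) (z : E n) {s : E n} (hs : s ∈ X ∩ Y) :
    ‖centralize X Y z - s‖ ≤ ‖z - s‖ := by
  have h1 := norm_proj_sub_le hX hXc z hs.1
  have h2 := norm_proj_sub_le hY hYc (proj X z) hs.2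
  have h3 := norm_proj_sub_le hX hXc (proj Y (proj X z)) hs.1
  have e : centralize X Y z - s = (1 / 2 : ℝ) • ((proj Y (proj X z) - s) +
      (proj X (proj Y (proj X z)) - s)) := by
    rw [centralize]; module
  rw [e, norm_smul, Real.norm_of_nonneg (by norm_num)]
  linarith [norm_add_le (proj Y (proj X z) - s) (proj X (proj Y (proj X z)) - s)]

theorem centralize_mem_affineSpan (hX : IsClosed X) (hY : IsClosed Y) (hne : (X ∩ Y).Nonempty)
    (haff : affineSpan ℝ X = affineSpan ℝ Y) (z : E n) :
    centralize X Y z ∈ affineSpan ℝ X := by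
  have h1 : proj Y (proj X z) ∈ affineSpan ℝ X := by
    rw [haff]; exact subset_affineSpan ℝ Y (proj_mem hY hne.right _).1
  have h2 : proj X (proj Y (proj X z)) ∈ affineSpan ℝ X :=
    subset_affineSpan ℝ X (proj_mem hX hne.left _).1
  have := (affineSpan ℝ X).convex h1 h2 (show (0 : ℝ) ≤ 1 / 2 by norm_num)
    (show (0 : ℝ) ≤ 1 / 2 by norm_num) (by norm_num)
  rwa [← smul_add] at this

/-- The new iterate is the projection of the centralized point onto the intersection of the two
half-spaces that support `X` and `Y` at its projections; this is recorded through the two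
equations of the bounding hyperplanes and the resulting strong Fejér inequality. The fourth clause is
the degenerate case `c ∈ Y`, in which only the half-space of `X` is left. -/
theorem step_spec (hX : IsClosed X) (hXc : Convex ℝ X) (hY : IsClosed Y)
    (hYc : Convex ℝ Y) (hne : (X ∩ Y).Nonempty) (z : E n) {c w : E n}
    (hc : c = centralize X Y z) (hw : w = step X Y z) :
    inner ℝ (c - proj X c) (w - proj X c) = 0 ∧ inner ℝ (c - proj Y c) (w - proj Y c) = 0 ∧
    (∃ α β : ℝ, w = c - α • (c - proj X c) - β • (c - proj Y c)) ∧
    (c - proj Y c = 0 → w = proj X c) ∧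
    (∀ s ∈ X ∩ Y, ‖w - s‖ ^ 2 + ‖w - c‖ ^ 2 ≤ ‖c - s‖ ^ 2) := by
  have huv : inner ℝ (c - proj X c) (c - proj Y c) ≤ 0 := by
    have := inner_centralize_le hX hXc hY hYc hne z
    rw [← hc] at this
    exact this.trans (by simp)
  have supp : ∀ (C : Set (E n)), IsClosed C → Convex ℝ C → ∀ s ∈ C,
      inner ℝ (s - c) (c - proj C c) ≤ -‖c - proj C c‖ ^ 2 := by
    intro C h1 h2 s hs
    have := inner_sub_proj_nonpos h1 h2 c hs
    rw [show s - c = (s - proj C c) - (c - proj C c) by abel, inner_sub_left,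
      real_inner_self_eq_norm_sq, real_inner_comm]
    linarith
  obtain ⟨s₀, hs₀⟩ := hne
  obtain ⟨w', α, β, hα, hβ, he, hcirc, hu, hv, h0⟩ := exists_isCircumcenter c _ _ s₀ huv
    (supp X hX hXc s₀ hs₀.1) (supp Y hY hYc s₀ hs₀.2)
  have hww : w' = w := by
    rw [hw, step, ← hc, hcirc.eq_circum, refl, refl]
    congr 1 <;> module
  subst hww
  have plane : ∀ p : E n, inner ℝ (w' - c) (c - p) = -‖c - p‖ ^ 2 →
      inner ℝ (c - p) (w' - p) = 0 := by
    intro p h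
    rw [show w' - p = (w' - c) + (c - p) by abel, inner_add_right, real_inner_self_eq_norm_sq,
      real_inner_comm, h]
    ring
  refine ⟨plane _ hu, plane _ hv, ⟨α, β, he⟩, fun h => ?_, fun s hs => ?_⟩
  · rw [h0 h]; abel
  · have hcw : c - w' = α • (c - proj X c) + β • (c - proj Y c) := by rw [he]; abel
    have key : 0 ≤ inner ℝ (w' - s) (c - w') := by
      have e : w' - s = (w' - c) - (s - c) := by abel
      rw [hcw, inner_add_right, inner_smul_right, inner_smul_right, e,
        inner_sub_left (w' - c) (s - c), inner_sub_left (w' - c) (s - c), hu, hv]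
      have h1 := supp X hX hXc s hs.1
      have h2 := supp Y hY hYc s hs.2
      exact add_nonneg (mul_nonneg hα (by linarith)) (mul_nonneg hβ (by linarith))
    rw [show c - s = (w' - s) + (c - w') by abel, norm_add_sq_real, norm_sub_rev w' c]
    linarith

theorem norm_step_sub_le (hX : IsClosed X) (hXc : Convex ℝ X) (hY : IsClosed Y)
    (hYc : Convex ℝ Y) (z : E n) {s : E n} (hs : s ∈ X ∩ Y) :
    ‖step X Y z - s‖ ≤ ‖z - s‖ := by
  have h := (step_spec hX hXc hY hYc ⟨s, hs⟩ z rfl rfl).2.2.2.2 s hs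
  refine le_trans (le_of_sq_le_sq ?_ (norm_nonneg _)) (norm_centralize_sub_le hX hXc hY hYc z hs)
  nlinarith [sq_nonneg ‖step X Y z - centralize X Y z‖]

theorem step_mem_affineSpan (hX : IsClosed X) (hXc : Convex ℝ X) (hY : IsClosed Y)
    (hYc : Convex ℝ Y) (hne : (X ∩ Y).Nonempty) (haff : affineSpan ℝ X = affineSpan ℝ Y)
    (z : E n) : step X Y z ∈ affineSpan ℝ X := by
  obtain ⟨α, β, h⟩ := (step_spec hX hXc hY hYc hne z rfl rfl).2.2.1
  have hc := centralize_mem_affineSpan hX hY hne haff z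
  set c := centralize X Y z
  have h1 : c - proj X c ∈ (affineSpan ℝ X).direction :=
    AffineSubspace.vsub_mem_direction hc (subset_affineSpan ℝ X (proj_mem hX hne.left _).1)
  have h2 : c - proj Y c ∈ (affineSpan ℝ X).direction :=
    AffineSubspace.vsub_mem_direction hc
      (haff ▸ subset_affineSpan ℝ Y (proj_mem hY hne.right _).1)
  have := AffineSubspace.vadd_mem_of_mem_direction
    (Submodule.neg_mem _ (Submodule.add_mem _ (Submodule.smul_mem _ α h1)
      (Submodule.smul_mem _ β h2))) hc
  rw [h]
  convert this using 1
  simp only [vadd_eq_add]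
  abel

/-- If the hyperplane through `p` orthogonal to `c - p` contains `w`, then `p` is at least as close
to `c` as `w` is. -/
theorem norm_sub_le_of_inner_eq_zero {c p w : E n} (h : inner ℝ (c - p) (w - p) = 0) :
    ‖c - p‖ ≤ ‖w - c‖ := by
  refine le_of_sq_le_sq ?_ (norm_nonneg _)
  rw [show w - c = (w - p) - (c - p) by abel, norm_sub_sq_real (w - p), real_inner_comm, h]
  linarith [sq_nonneg ‖w - p‖]

end Step

/-! ### Convergence and the error bound -/

section Convergence

variable {n : ℕ} {X Y : Set (E n)}

/-- The iterates converge: they are Fejér monotone with respect to `X ∩ Y`, the steps away from the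
centralized points tend to zero, and these steps dominate the distances to both sets. -/
theorem exists_tendsto_of_step (hX : IsClosed X) (hXc : Convex ℝ X) (hY : IsClosed Y)
    (hYc : Convex ℝ Y) (hne : (X ∩ Y).Nonempty) {z : ℕ → E n}
    (hz : ∀ k, z (k + 1) = step X Y (z k)) :
    ∃ zbar ∈ X ∩ Y, Tendsto z atTop (𝓝 zbar) := by
  have hanti : ∀ s ∈ X ∩ Y, Antitone fun k => ‖z k - s‖ := fun s hs =>
    antitone_nat_of_succ_le fun k => by
      rw [hz k]; exact norm_step_sub_le hX hXc hY hYc (z k) hs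
  obtain ⟨s, hs⟩ := hne
  have hne : (X ∩ Y).Nonempty := ⟨s, hs⟩
  set c : ℕ → E n := fun k => centralize X Y (z k) with hc
  -- the displacements `z (k + 1) - c k` tend to zero
  have hlim : Tendsto (fun k => ‖z (k + 1) - c k‖) atTop (𝓝 0) := by
    obtain ⟨l, hl⟩ : ∃ l, Tendsto (fun k => ‖z k - s‖) atTop (𝓝 l) :=
      ⟨_, tendsto_atTop_ciInf (hanti s hs) ⟨0, by rintro _ ⟨k, rfl⟩; exact norm_nonneg _⟩⟩
    have h2 : Tendsto (fun k => ‖z k - s‖ ^ 2 - ‖z (k + 1) - s‖ ^ 2) atTop (𝓝 0) := by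
      have := (hl.pow 2).sub (((tendsto_add_atTop_iff_nat 1).2 hl).pow 2)
      rwa [sub_self] at this
    have h3 : Tendsto (fun k => ‖z (k + 1) - c k‖ ^ 2) atTop (𝓝 0) := by
      refine squeeze_zero (fun k => sq_nonneg _) (fun k => ?_) h2
      have h := (step_spec hX hXc hY hYc hne (z k) rfl rfl).2.2.2.2 s hs
      have h' := norm_centralize_sub_le hX hXc hY hYc (z k) hs
      rw [hz k]
      have := pow_le_pow_left₀ (norm_nonneg _) h' 2
      simp only [hc]
      linarith
    have := h3.sqrt
    simpa [Real.sqrt_sq (norm_nonneg _)] using this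
  have hdist : ∀ C : Set (E n), IsClosed C → C.Nonempty →
      (∀ k, inner ℝ (c k - proj C (c k)) (z (k + 1) - proj C (c k)) = 0) →
      Tendsto (fun k => Metric.infDist (z k) C) atTop (𝓝 0) := by
    intro C hC hCne h
    refine (tendsto_add_atTop_iff_nat 1).1 (squeeze_zero (fun k => Metric.infDist_nonneg)
      (fun k => ?_) (by simpa using hlim.const_mul 2))
    have h1 := norm_sub_le_of_inner_eq_zero (h k)
    have h2 := infDist_le_norm_sub (proj_mem hC hCne (c k)).1 (z (k + 1))
    have h3 := norm_sub_le_norm_sub_add_norm_sub (z (k + 1)) (c k) (proj C (c k))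
    linarith
  have hdX := hdist X hX hne.left fun k => by
    rw [hz k]; exact (step_spec hX hXc hY hYc hne (z k) rfl rfl).1
  have hdY := hdist Y hY hne.right fun k => by
    rw [hz k]; exact (step_spec hX hXc hY hYc hne (z k) rfl rfl).2.1
  obtain ⟨a, -, φ, hφ, ha⟩ := tendsto_subseq_of_bounded
    (Metric.isBounded_closedBall (x := s) (r := ‖z 0 - s‖)) (x := z) fun k => by
      rw [mem_closedBall_iff_norm]; exact hanti s hs (Nat.zero_le k)
  have hmem : ∀ C : Set (E n), IsClosed C → C.Nonempty →
      Tendsto (fun k => Metric.infDist (z k) C) atTop (𝓝 0) → a ∈ C := by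
    intro C hC hCne h
    rw [hC.mem_iff_infDist_zero hCne]
    exact tendsto_nhds_unique
      (((Metric.continuous_infDist_pt C).tendsto a).comp ha) (h.comp hφ.tendsto_atTop)
  have haXY : a ∈ X ∩ Y := ⟨hmem X hX hne.left hdX, hmem Y hY hne.right hdY⟩
  refine ⟨a, haXY, ?_⟩
  rw [tendsto_iff_norm_sub_tendsto_zero] at ha ⊢
  exact (tendsto_iff_tendsto_subseq_of_antitone (hanti a haXY) hφ.tendsto_atTop).2 ha

/-- Convex sets with the same affine hull whose relative interiors meet satisfy a local error bound
at every common point: a small shift towards a common relatively interior point brings a point that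
is close to both sets into their intersection. -/
theorem exists_errorBound (hX : IsClosed X) (hXc : Convex ℝ X) (hY : IsClosed Y)
    (hYc : Convex ℝ Y) (haff : affineSpan ℝ X = affineSpan ℝ Y)
    (hri : (intrinsicInterior ℝ X ∩ intrinsicInterior ℝ Y).Nonempty) {zbar : E n}
    (hzbar : zbar ∈ X ∩ Y) : ∃ ω, ErrorBound X Y zbar ω := by
  obtain ⟨c, hcX, hcY⟩ := hri
  have ball : ∀ C : Set (E n), c ∈ intrinsicInterior ℝ C →
      ∃ r > 0, ∀ w ∈ affineSpan ℝ C, dist w c < r → w ∈ C := by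
    rintro C ⟨⟨c', hc'⟩, hint, rfl⟩
    obtain ⟨r, hr, h⟩ := Metric.mem_nhds_iff.1 (mem_interior_iff_mem_nhds.1 hint)
    exact ⟨r, hr, fun w hw hd => h (show (⟨w, hw⟩ : affineSpan ℝ C) ∈ Metric.ball _ r from hd)⟩
  obtain ⟨r₁, hr₁, hb₁⟩ := ball X hcX
  obtain ⟨r₂, hr₂, hb₂⟩ := ball Y hcY
  set r := min r₁ r₂ / 2 with hr
  have hrpos : 0 < r := by positivity
  have hcA : c ∈ affineSpan ℝ X := subset_affineSpan ℝ X (intrinsicInterior_subset hcX)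
  -- shifting a point at distance at most `D` from `C` towards `c`
  have shift : ∀ C : Set (E n), Convex ℝ C →
      (∀ w ∈ affineSpan ℝ X, ‖w - c‖ ≤ r → w ∈ C) → ∀ p q : E n, p ∈ affineSpan ℝ X →
      q ∈ affineSpan ℝ X → q ∈ C → ∀ D : ℝ, 0 < D → ‖p - q‖ ≤ D →
      (r / (r + D)) • p + (D / (r + D)) • c ∈ C := by
    intro C hC hb p q hp hq hqC D hD hpq
    have hm : c + (r / D) • (p - q) ∈ C := by
      refine hb _ ?_ ?_
      · have := AffineSubspace.vadd_mem_of_mem_direction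
          (Submodule.smul_mem _ (r / D) (AffineSubspace.vsub_mem_direction hp hq)) hcA
        rwa [vadd_eq_add, vsub_eq_sub, add_comm] at this
      · rw [add_sub_cancel_left, norm_smul, Real.norm_of_nonneg (by positivity), div_mul_eq_mul_div,
          div_le_iff₀ hD]
        exact mul_le_mul_of_nonneg_left hpq hrpos.le
    have := hC hqC hm (show 0 ≤ r / (r + D) by positivity) (show 0 ≤ D / (r + D) by positivity)
      (by field_simp)
    convert this using 1
    have e : D / (r + D) * (r / D) = r / (r + D) := by field_simp
    rw [smul_add, smul_smul, e]
    module
  set M := ‖zbar - c‖ + 2 with hM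
  have hMpos : 0 < M := by positivity
  set K := 1 + 2 * M / r with hK
  have hKpos : 1 < K := by rw [hK]; linarith [show 0 < 2 * M / r by positivity]
  refine ⟨1 / (K + 1), ⟨by positivity, (div_lt_one (by positivity)).2 (by linarith)⟩, ?_⟩
  filter_upwards [Metric.ball_mem_nhds zbar one_pos] with w hw
  rw [Metric.mem_ball, dist_eq_norm] at hw
  set d := max (Metric.infDist w X) (Metric.infDist w Y) with hd
  have hd0 : 0 ≤ d := le_max_of_le_left Metric.infDist_nonneg
  obtain ⟨hp, hpd⟩ := proj_mem hX ⟨zbar, hzbar.1⟩ w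
  obtain ⟨hq, hqd⟩ := proj_mem hY ⟨zbar, hzbar.2⟩ w
  have hpn := norm_proj_sub_le hX hXc w hzbar.1
  set p := proj X w
  set q := proj Y w
  rw [dist_eq_norm] at hpd hqd
  have hpd' : ‖w - p‖ ≤ d := hpd.le.trans (le_max_left _ _)
  have hqd' : ‖w - q‖ ≤ d := hqd.le.trans (le_max_right _ _)
  have key : Metric.infDist w (X ∩ Y) ≤ K * d := by
    rcases hd0.eq_or_lt with h0 | hpos
    · rw [← h0] at hpd' hqd' ⊢
      have e1 : w = p := sub_eq_zero.1 (norm_le_zero_iff.1 hpd')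
      have e2 : w = q := sub_eq_zero.1 (norm_le_zero_iff.1 hqd')
      rw [mul_zero, Metric.infDist_zero_of_mem (show w ∈ X ∩ Y from ⟨e1 ▸ hp, e2 ▸ hq⟩)]
    have hpA := subset_affineSpan ℝ X hp
    have hqA : q ∈ affineSpan ℝ X := haff ▸ subset_affineSpan ℝ Y hq
    have hD : 0 < 2 * d := by positivity
    have hpq : ‖p - q‖ ≤ 2 * d := by
      have := norm_sub_le_norm_sub_add_norm_sub p w q
      rw [norm_sub_rev p w] at this
      linarith
    have hrr : r < r₁ ∧ r < r₂ := by
      have := min_le_left r₁ r₂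
      have := min_le_right r₁ r₂
      have := lt_min hr₁ hr₂
      constructor <;> linarith
    have h1 := shift X hXc (fun v hv h => hb₁ v hv (by rw [dist_eq_norm]; linarith [hrr.1]))
      p p hpA hpA hp (2 * d) hD (by simp [hD.le])
    have h2 := shift Y hYc
      (fun v hv h => hb₂ v (haff ▸ hv) (by rw [dist_eq_norm]; linarith [hrr.2]))
      p q hpA hqA hq (2 * d) hD hpq
    set v := (r / (r + 2 * d)) • p + (2 * d / (r + 2 * d)) • c with hv
    have hvp : ‖p - v‖ ≤ 2 * d / r * M := by
      have e : p - v = (2 * d / (r + 2 * d)) • (p - c) := by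
        have : r / (r + 2 * d) = 1 - 2 * d / (r + 2 * d) := by field_simp; ring
        rw [hv, this]; module
      rw [e, norm_smul, Real.norm_of_nonneg (by positivity)]
      have hpc : ‖p - c‖ ≤ M := by
        have := norm_sub_le_norm_sub_add_norm_sub p zbar c
        linarith
      refine mul_le_mul ?_ hpc (norm_nonneg _) (by positivity)
      exact div_le_div_of_nonneg_left hD.le hrpos (by linarith)
    have h3 := infDist_le_norm_sub (show v ∈ X ∩ Y from ⟨h1, h2⟩) w
    have h4 := norm_sub_le_norm_sub_add_norm_sub w p v
    have e : K * d = d + 2 * d / r * M := by rw [hK]; ring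
    linarith
  rw [div_mul_eq_mul_div, one_mul, div_le_iff₀ (by positivity)]
  nlinarith

end Convergence

/-! ### Sublevel sets of `C²` functions -/

section SecondOrder

open Asymptotics

/-- Second order Taylor expansion with both points varying near `x₀` and the Hessian frozen
at `x₀`. -/
theorem eventually_taylor_two {V : Type*} [NormedAddCommGroup V] [NormedSpace ℝ V] {g : V → ℝ}
    {x₀ : V} (hg : ContDiffAt ℝ 2 g x₀) {ε : ℝ} (hε : 0 < ε) :
    ∀ᶠ q : V × V in 𝓝 (x₀, x₀),
      |g q.2 - g q.1 - fderiv ℝ g q.1 (q.2 - q.1) -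
        1 / 2 * fderiv ℝ (fderiv ℝ g) x₀ (q.2 - q.1) (q.2 - q.1)| ≤ ε * ‖q.2 - q.1‖ ^ 2 := by
  set B := fderiv ℝ (fderiv ℝ g) x₀ with hB
  have hsymm : ∀ v w, B v w = B w v := hg.isSymmSndFDerivAt (by simp)
  have hg' : HasStrictFDerivAt (fderiv ℝ g) B x₀ :=
    (hg.fderiv_right (m := 1) (by norm_num)).hasStrictFDerivAt (by norm_num)
  have hdiff : ∀ᶠ x in 𝓝 x₀, DifferentiableAt ℝ g x :=
    (hg.eventually (by simp)).mono fun x hx => hx.differentiableAt (by norm_num)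
  have hlit : ∀ᶠ q : V × V in 𝓝 (x₀, x₀),
      ‖fderiv ℝ g q.1 - fderiv ℝ g q.2 - B (q.1 - q.2)‖ ≤ ε * ‖q.1 - q.2‖ :=
    hg'.isLittleO.def hε
  have hall := hlit.and (continuousAt_fst.eventually hdiff :
    ∀ᶠ q : V × V in 𝓝 (x₀, x₀), DifferentiableAt ℝ g q.1)
  obtain ⟨δ, hδ, hball⟩ := Metric.eventually_nhds_iff_ball.1 hall
  filter_upwards [Metric.ball_mem_nhds (x₀, x₀) hδ] with ⟨p, w⟩ hq
  rw [← ball_prod_same, mem_prod] at hq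
  obtain ⟨hp, hw⟩ := hq
  have hseg : segment ℝ p w ⊆ Metric.ball x₀ δ := (convex_ball x₀ δ).segment_subset hp hw
  have hd : ∀ x ∈ segment ℝ p w, HasFDerivWithinAt
      (fun x => g x - fderiv ℝ g p (x - p) - 1 / 2 * B (x - p) (x - p))
      (fderiv ℝ g x - fderiv ℝ g p - B (x - p)) (segment ℝ p w) x := by
    intro x hx
    have h1 := (hball (x, p) (by rw [← ball_prod_same]; exact ⟨hseg hx, hp⟩)).2.hasFDerivAt
    have h2 : HasFDerivAt (fun x : V => x - p) (ContinuousLinearMap.id ℝ V) x :=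
      (hasFDerivAt_id x).sub_const p
    have h3 := (fderiv ℝ g p).hasFDerivAt.comp x h2
    have h4 := ((B.hasFDerivAt.comp x h2).clm_apply h2).const_mul (1 / 2 : ℝ)
    refine (((h1.sub h3).sub h4).congr_fderiv ?_).hasFDerivWithinAt
    ext v
    simp only [ContinuousLinearMap.comp_id, sub_apply, smul_apply, add_apply,
      ContinuousLinearMap.flip_apply, Function.comp_apply, smul_eq_mul]
    rw [hsymm v (x - p)]
    ring
  have hbound : ∀ x ∈ segment ℝ p w,
      ‖fderiv ℝ g x - fderiv ℝ g p - B (x - p)‖ ≤ ε * ‖w - p‖ := by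
    intro x hx
    refine (hball (x, p) (by rw [← ball_prod_same]; exact ⟨hseg hx, hp⟩)).1.trans ?_
    refine mul_le_mul_of_nonneg_left ?_ hε.le
    have := norm_sub_le_of_mem_segment hx
    exact this
  have := (convex_segment p w).norm_image_sub_le_of_norm_hasFDerivWithin_le hd hbound
    (left_mem_segment ℝ p w) (right_mem_segment ℝ p w)
  simp only [sub_self, map_zero, mul_zero, sub_zero, Real.norm_eq_abs] at this
  convert this using 1
  · congr 1; ring
  · ring

/-- A bilinear form that is at most `K ‖v‖²` on the vectors `v` orthogonal to the unit vector `N` is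
almost so bounded at vectors `h` making a small angle with that hyperplane. -/
theorem apply_self_le_of_almost_tangent {V : Type*} [NormedAddCommGroup V]
    [InnerProductSpace ℝ V] (B : V →L[ℝ] V →L[ℝ] ℝ) {N h : V} (hN : ‖N‖ = 1) {K σ : ℝ}
    (hK : 0 ≤ K) (hB : ∀ v, inner ℝ N v = 0 → |B v v| ≤ K * ‖v‖ ^ 2)
    (hh : |inner ℝ N h| ≤ σ * ‖h‖) : B h h ≤ (K + 2 * ‖B‖ * σ) * ‖h‖ ^ 2 := by
  set a : ℝ := inner ℝ N h with ha
  set τ := h - a • N with hτ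
  have hhτ : h = τ + a • N := by rw [hτ]; abel
  have hNτ : inner ℝ N τ = 0 := by
    rw [hτ, inner_sub_right, inner_smul_right, real_inner_self_eq_norm_sq, hN, ← ha]; ring
  have hτh : ‖τ‖ ≤ ‖h‖ := by
    refine le_of_sq_le_sq ?_ (norm_nonneg _)
    rw [hhτ, norm_add_sq_real, inner_smul_right, real_inner_comm, hNτ]
    linarith [sq_nonneg ‖a • N‖]
  have hBτ : B τ τ ≤ K * ‖h‖ ^ 2 :=
    (le_abs_self _).trans ((hB τ hNτ).trans
      (mul_le_mul_of_nonneg_left (pow_le_pow_left₀ (norm_nonneg _) hτh 2) hK))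
  have hexp : B h h = B τ τ + a * B τ N + a * B N h := by
    have h1 : B h h = B τ h + a * B N h := by
      have := congrArg (fun x => B x h) hhτ
      simpa only [map_add, map_smul, add_apply, smul_apply, smul_eq_mul] using this
    have h2 : B τ h = B τ τ + a * B τ N := by
      have := congrArg (fun x => B τ x) hhτ
      simpa only [map_add, map_smul, smul_eq_mul] using this
    rw [h1, h2]
  have hcross : ∀ b : ℝ, |b| ≤ ‖B‖ * ‖h‖ → a * b ≤ ‖B‖ * σ * ‖h‖ ^ 2 := by
    intro b hb
    calc a * b ≤ |a| * |b| := by rw [← abs_mul]; exact le_abs_self _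
      _ ≤ (σ * ‖h‖) * (‖B‖ * ‖h‖) :=
        mul_le_mul hh hb (abs_nonneg _) ((abs_nonneg _).trans hh)
      _ = _ := by ring
  have h1 := hcross (B τ N) (by
    have := B.le_opNorm₂ τ N
    rw [hN, mul_one] at this
    exact this.trans (mul_le_mul_of_nonneg_left hτh (norm_nonneg B)))
  have h2 := hcross (B N h) (by
    have := B.le_opNorm₂ N h
    rwa [hN, mul_one] at this)
  rw [hexp]
  linarith

/-- Let `u ≠ 0` be a normal vector at `p` to the sublevel set `{g ≤ 0}` near `p`. Then a displacement
in the half-space `⟪u, ·⟫ ≤ 0` is not an ascent direction: descent directions `h` satisfy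
`⟪u, h⟫ ≤ 0`, so they fill a half-space contained in that of `u`, unless the gradient vanishes. -/
theorem fderiv_nonpos_of_normal {V : Type*} [NormedAddCommGroup V]
    [InnerProductSpace ℝ V] {g : V → ℝ} {p u k : V} (hg : DifferentiableAt ℝ g p)
    (hp : g p ≤ 0) (hu : u ≠ 0) (hn : ∀ᶠ s in 𝓝 p, g s ≤ 0 → inner ℝ u (s - p) ≤ 0)
    (hk : inner ℝ u k ≤ 0) : fderiv ℝ g p k ≤ 0 := by
  have desc : ∀ h : V, fderiv ℝ g p h < 0 → inner ℝ u h ≤ 0 := by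
    intro h hh
    have hline : HasDerivAt (fun t : ℝ => p + t • h) h 0 := by
      simpa using ((hasDerivAt_id (0 : ℝ)).smul_const h).const_add p
    have hd : HasDerivAt (fun t : ℝ => g (p + t • h)) (fderiv ℝ g p h) 0 := by
      have hg' : HasFDerivAt g (fderiv ℝ g p) (p + (0 : ℝ) • h) := by
        simpa using hg.hasFDerivAt
      exact hg'.comp_hasDerivAt 0 hline
    have h1 : ∀ᶠ t in 𝓝[>] (0 : ℝ), slope (fun t : ℝ => g (p + t • h)) 0 t < 0 :=
      ((hasDerivAt_iff_tendsto_slope.1 hd).mono_left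
        (nhdsWithin_mono 0 fun t ht => ne_of_gt ht)).eventually (gt_mem_nhds hh)
    have h2 : Tendsto (fun t : ℝ => p + t • h) (𝓝[>] 0) (𝓝 p) := by
      have := hline.continuousAt.tendsto
      simp only [zero_smul, add_zero] at this
      exact this.mono_left nhdsWithin_le_nhds
    obtain ⟨t, ht1, ht2, ht3⟩ := (h1.and ((h2.eventually hn).and self_mem_nhdsWithin)).exists
    have ht : (0 : ℝ) < t := ht3
    rw [slope_def_field, sub_zero, div_neg_iff] at ht1
    have hneg : g (p + t • h) ≤ 0 := by
      rcases ht1 with h | h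
      · linarith [h.2]
      · have := h.1
        simp only [zero_smul, add_zero] at this
        linarith
    have := ht2 hneg
    rw [add_sub_cancel_left, inner_smul_right] at this
    exact nonpos_of_mul_nonpos_right this ht
  by_contra! hpos
  -- tilting `-k` slightly towards `u` gives a descent direction on the wrong side
  set b := |fderiv ℝ g p u| + 1 with hb
  have hb0 : 0 < b := by positivity
  have h1 : fderiv ℝ g p (-k + (fderiv ℝ g p k / b) • u) < 0 := by
    rw [map_add, map_neg, map_smul, smul_eq_mul, div_mul_eq_mul_div]
    have : fderiv ℝ g p k * fderiv ℝ g p u / b < fderiv ℝ g p k := by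
      rw [div_lt_iff₀ hb0]
      exact mul_lt_mul_of_pos_left (by linarith [le_abs_self (fderiv ℝ g p u)]) hpos
    linarith
  have h2 := desc _ h1
  rw [inner_add_right, inner_neg_right, inner_smul_right, real_inner_self_eq_norm_sq] at h2
  have h3 : 0 < fderiv ℝ g p k / b * ‖u‖ ^ 2 := by
    have := norm_pos_iff.2 hu
    positivity
  linarith

variable {V : Type*} [NormedAddCommGroup V] [InnerProductSpace ℝ V] [CompleteSpace V]

/-- Let `g` be `C²` with nonzero gradient `∇` at `0` and second derivative bounded by `κ ‖∇‖` on
the tangent space `∇ᗮ`. If `p` lies in `{g ≤ 0}` and `w` lies on the inner side of the hyperplane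
through `p` normal to the gradient at `p`, then moving `w` by `(κ / 2 + ε) ‖w - p‖²` against `∇`
leads into `{g ≤ 0}`. -/
theorem eventually_sub_smul_gradient_nonpos {g : V → ℝ} (hg : ContDiffAt ℝ 2 g 0)
    (hgrad : gradient g 0 ≠ 0) {κ : ℝ} (hκ : 0 ≤ κ)
    (hB : ∀ v, inner ℝ (gradient g 0) v = 0 →
      |fderiv ℝ (fderiv ℝ g) 0 v v| ≤ κ * ‖gradient g 0‖ * ‖v‖ ^ 2) {ε : ℝ} (hε : 0 < ε) :
    ∀ᶠ q : V × V in 𝓝 (0, 0), g q.1 ≤ 0 → fderiv ℝ g q.1 (q.2 - q.1) ≤ 0 →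
      g (q.2 - ((κ / 2 + ε) * ‖q.2 - q.1‖ ^ 2) • (‖gradient g 0‖⁻¹ • gradient g 0)) ≤ 0 := by
  set G := ‖gradient g 0‖ with hGdef
  have hG : 0 < G := norm_pos_iff.2 hgrad
  set N := G⁻¹ • gradient g 0 with hN
  set B := fderiv ℝ (fderiv ℝ g) 0 with hBdef
  have hN1 : ‖N‖ = 1 := by
    rw [hN, norm_smul, norm_inv, Real.norm_of_nonneg hG.le, ← hGdef, inv_mul_cancel₀ hG.ne']
  have hgN : gradient g 0 = G • N := by rw [hN, smul_smul, mul_inv_cancel₀ hG.ne', one_smul]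
  have hfd : ∀ v, fderiv ℝ g 0 v = G * inner ℝ N v := by
    intro v
    rw [← toDual_gradient, InnerProductSpace.toDual_apply_apply, hgN, real_inner_smul_left]
  set M := ‖B‖ with hM
  have hM0 : 0 ≤ M := norm_nonneg B
  -- tolerances: `σ` for the angle with the tangent space, `η` for the variation of the gradient
  set σ := ε * G / (4 * (M + 1)) with hσ
  have hσ0 : 0 < σ := by positivity
  set η := min (ε * G / (4 * (κ / 2 + ε))) (σ * G / 2) with hη
  have hη0 : 0 < η := by positivity
  have hη1 : (κ / 2 + ε) * η ≤ ε * G / 4 := by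
    have := min_le_left (ε * G / (4 * (κ / 2 + ε))) (σ * G / 2)
    rw [← hη, le_div_iff₀ (by positivity)] at this
    linarith
  have hη2 : η ≤ σ * G / 2 := min_le_right _ _
  have hηG : η ≤ G := by
    have : ε * η ≤ ε * G := by nlinarith [mul_nonneg hκ hη0.le, mul_pos hε hG]
    exact le_of_mul_le_mul_left this hε
  have hMσ : 2 * M * σ ≤ ε * G / 2 := by
    have : σ * (4 * (M + 1)) = ε * G := by rw [hσ]; field_simp
    linarith
  have hsub : Tendsto (fun q : V × V => ‖q.2 - q.1‖) (𝓝 (0, 0)) (𝓝 0) := by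
    have : Continuous fun q : V × V => ‖q.2 - q.1‖ := by fun_prop
    simpa using this.tendsto (0, 0)
  have hsmall : ∀ᶠ q : V × V in 𝓝 (0, 0),
      (M / 2 + ε * G / 4) * ‖q.2 - q.1‖ ≤ σ * G / 2 := by
    have h := hsub.const_mul (M / 2 + ε * G / 4)
    rw [mul_zero] at h
    exact (h.eventually (gt_mem_nhds (show 0 < σ * G / 2 by positivity))).mono fun _ h => h.le
  have hderiv : ∀ᶠ q : V × V in 𝓝 (0, 0), ‖fderiv ℝ g q.1 - fderiv ℝ g 0‖ ≤ η := by
    have hcont : ContinuousAt (fderiv ℝ g) 0 :=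
      (hg.fderiv_right (m := 1) (by norm_num)).continuousAt
    have h : Tendsto (fun q : V × V => fderiv ℝ g q.1) (𝓝 (0, 0)) (𝓝 (fderiv ℝ g 0)) :=
      hcont.tendsto.comp continuousAt_fst
    filter_upwards [h.eventually (Metric.closedBall_mem_nhds _ hη0)] with q hq
    rw [← dist_eq_norm]
    exact hq
  have hstrict : ∀ᶠ q : V × V in 𝓝 (0, 0),
      ‖g (q.2 - ((κ / 2 + ε) * ‖q.2 - q.1‖ ^ 2) • N) - g q.2 -
        fderiv ℝ g 0 (q.2 - ((κ / 2 + ε) * ‖q.2 - q.1‖ ^ 2) • N - q.2)‖ ≤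
        η * ‖q.2 - ((κ / 2 + ε) * ‖q.2 - q.1‖ ^ 2) • N - q.2‖ := by
    have hs := (hg.hasStrictFDerivAt (by norm_num)).isLittleO.def hη0
    have hc : Continuous fun q : V × V =>
        (q.2 - ((κ / 2 + ε) * ‖q.2 - q.1‖ ^ 2) • N, q.2) := by fun_prop
    have ht := hc.tendsto (0, 0)
    simp only [sub_self, norm_zero, ne_eq, OfNat.ofNat_ne_zero, not_false_eq_true, zero_pow,
      mul_zero, zero_smul] at ht
    exact ht.eventually hs
  filter_upwards [eventually_taylor_two hg (show 0 < ε * G / 4 by positivity), hsmall, hderiv,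
    hstrict] with ⟨p, w⟩ htay hsm hde hst hp hpw
  simp only at *
  set h := w - p with hh
  set t := (κ / 2 + ε) * ‖h‖ ^ 2 with ht
  have ht0 : 0 ≤ t := by positivity
  have hBle : ∀ a b, |B a b| ≤ M * ‖a‖ * ‖b‖ := fun a b => B.le_opNorm₂ a b
  have hgw : g w ≤ fderiv ℝ g p h + 1 / 2 * B h h + ε * G / 4 * ‖h‖ ^ 2 := by
    linarith [(abs_le.1 htay).2]
  have hvar : |fderiv ℝ g p h - fderiv ℝ g 0 h| ≤ η * ‖h‖ := by
    have := (fderiv ℝ g p - fderiv ℝ g 0).le_of_opNorm_le hde h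
    rwa [sub_apply, Real.norm_eq_abs] at this
  rw [hfd] at hvar
  set a : ℝ := inner ℝ N h with ha
  have hmain : g w ≤ t * (G - η) := by
    have hright : (κ * G / 2 + ε * G / 2) * ‖h‖ ^ 2 ≤ t * (G - η) := by
      have : κ * G / 2 + ε * G / 2 ≤ (κ / 2 + ε) * (G - η) := by
        have := mul_pos hε hG
        linarith
      calc _ ≤ (κ / 2 + ε) * (G - η) * ‖h‖ ^ 2 := mul_le_mul_of_nonneg_right this (sq_nonneg _)
        _ = _ := by rw [ht]; ring
    rcases lt_or_ge a (-(σ * ‖h‖)) with hlt | hge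
    · -- `h` points well inside, so the first order term dominates
      have h1 : fderiv ℝ g p h ≤ -(σ * G / 2) * ‖h‖ := by
        have := (abs_le.1 hvar).2
        have := mul_lt_mul_of_pos_left hlt hG
        have := mul_le_mul_of_nonneg_right hη2 (norm_nonneg h)
        linarith
      have h2 := (le_abs_self _).trans (hBle h h)
      have h3 := mul_le_mul_of_nonneg_right hsm (norm_nonneg h)
      have h4 : 0 ≤ t * (G - η) := mul_nonneg ht0 (by linarith)
      have h5 : (M / 2 + ε * G / 4) * ‖h‖ * ‖h‖ =
        1 / 2 * (M * ‖h‖ * ‖h‖) + ε * G / 4 * ‖h‖ ^ 2 := by ring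
      linarith
    · -- `h` is almost tangent, so the second order term is governed by `κ`
      have hle : a ≤ σ * ‖h‖ := by
        have h1 := (abs_le.1 hvar).1
        have h2 : G * a ≤ G * (σ * ‖h‖) := by
          have := mul_le_mul_of_nonneg_right hη2 (norm_nonneg h)
          have := mul_nonneg (mul_nonneg hσ0.le hG.le) (norm_nonneg h)
          linarith
        exact le_of_mul_le_mul_left h2 hG
      have habs : |a| ≤ σ * ‖h‖ := abs_le.2 ⟨hge, hle⟩
      have hBh := apply_self_le_of_almost_tangent B hN1 (by positivity : 0 ≤ κ * G)
        (fun v hv => hB v (by rw [hgN, real_inner_smul_left, hv, mul_zero])) habs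
      have h1 : fderiv ℝ g p h ≤ 0 := hpw
      refine le_trans ?_ hright
      have h4 := mul_le_mul_of_nonneg_right hMσ (sq_nonneg ‖h‖)
      have h5 : (κ * G + 2 * M * σ) * ‖h‖ ^ 2 =
        κ * G * ‖h‖ ^ 2 + 2 * M * σ * ‖h‖ ^ 2 := by ring
      have h6 : B h h ≤ κ * G * ‖h‖ ^ 2 + 2 * M * σ * ‖h‖ ^ 2 := h5 ▸ hBh
      have h7 : (κ * G / 2 + ε * G / 2) * ‖h‖ ^ 2 =
        1 / 2 * (κ * G * ‖h‖ ^ 2) + ε * G / 2 * ‖h‖ ^ 2 := by ring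
      rw [h7]
      linarith
  have e : w - t • N - w = -(t • N) := by abel
  rw [e, map_neg, map_smul, hfd, norm_neg, norm_smul, hN1, Real.norm_of_nonneg ht0,
    real_inner_self_eq_norm_sq, hN1, smul_eq_mul, Real.norm_eq_abs] at hst
  have := (abs_le.1 hst).2
  linarith

end SecondOrder

/-! ### Second order contact of supporting half-spaces -/

/-- Near `zbar`, every half-space supporting `C` from within its affine hull exceeds `C` by at most
`K` times the squared distance to the point of support: if `w ∈ aff C` lies in a half-space
supporting `C` at `p` with normal `u ≠ 0`, then `dist (w, C) ≤ K ‖w - p‖²`. -/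
def HasQuadraticSupport {n : ℕ} (C : Set (E n)) (zbar : E n) (K : ℝ) : Prop :=
  ∀ᶠ q : E n × E n in 𝓝 (zbar, zbar), q.1 ∈ C → q.2 ∈ affineSpan ℝ C →
    ∀ u ∈ dirSpace C, u ≠ 0 → (∀ s ∈ C, inner ℝ u (s - q.1) ≤ 0) →
      inner ℝ u (q.2 - q.1) ≤ 0 → Metric.infDist q.2 C ≤ K * ‖q.2 - q.1‖ ^ 2

theorem HasQuadraticSupport.mono {n : ℕ} {C : Set (E n)} {zbar : E n} {K L : ℝ}
    (h : HasQuadraticSupport C zbar K) (hKL : K ≤ L) : HasQuadraticSupport C zbar L :=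
  Eventually.mono h fun _ hq h1 h2 u h3 h4 h5 h6 =>
    (hq h1 h2 u h3 h4 h5 h6).trans (mul_le_mul_of_nonneg_right hKL (sq_nonneg _))

section Curvature

variable {n : ℕ} {C : Set (E n)}

theorem curvature_nonneg (g : dirSpace C → ℝ) : 0 ≤ curvature g := by
  refine Real.sSup_nonneg ?_
  rintro _ ⟨v, -, rfl⟩
  positivity

theorem abs_apply_self_le_sSup_mul {V : Type*} [NormedAddCommGroup V] [InnerProductSpace ℝ V]
    (B : V →L[ℝ] V →L[ℝ] ℝ) {a v : V} (ha : a ≠ 0) (hv : inner ℝ a v = 0) :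
    |B v v| ≤ sSup ((fun v => |B v v| / ‖a‖) '' {v | inner ℝ a v = 0 ∧ ‖v‖ = 1}) *
      ‖a‖ * ‖v‖ ^ 2 := by
  have hG : 0 < ‖a‖ := norm_pos_iff.2 ha
  rcases eq_or_ne v 0 with rfl | hv0
  · simp
  have hvn : 0 < ‖v‖ := norm_pos_iff.2 hv0
  have hbdd : BddAbove ((fun v => |B v v| / ‖a‖) '' {v | inner ℝ a v = 0 ∧ ‖v‖ = 1}) := by
    refine ⟨‖B‖ / ‖a‖, ?_⟩
    rintro _ ⟨x, ⟨-, hx⟩, rfl⟩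
    have := B.le_opNorm₂ x x
    rw [hx, mul_one, mul_one] at this
    exact div_le_div_of_nonneg_right this hG.le
  have hle : |B (‖v‖⁻¹ • v) (‖v‖⁻¹ • v)| / ‖a‖ ≤
      sSup ((fun v => |B v v| / ‖a‖) '' {v | inner ℝ a v = 0 ∧ ‖v‖ = 1}) := by
    refine le_csSup hbdd ⟨‖v‖⁻¹ • v, ⟨?_, ?_⟩, rfl⟩
    · rw [inner_smul_right, hv, mul_zero]
    · rw [norm_smul, norm_inv, norm_norm, inv_mul_cancel₀ hvn.ne']
  rw [div_le_iff₀ hG, map_smul, map_smul, smul_apply, smul_eq_mul, smul_eq_mul, abs_mul, abs_mul,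
    abs_inv, abs_norm] at hle
  have h2 := mul_le_mul_of_nonneg_right hle (sq_nonneg ‖v‖)
  calc |B v v| = ‖v‖⁻¹ * (‖v‖⁻¹ * |B v v|) * ‖v‖ ^ 2 := by field_simp
    _ ≤ _ := h2

theorem abs_fderiv_fderiv_le_curvature {g : dirSpace C → ℝ} (hgrad : gradient g 0 ≠ 0)
    {v : dirSpace C} (hv : inner ℝ (gradient g 0) v = 0) :
    |fderiv ℝ (fderiv ℝ g) 0 v v| ≤ curvature g * ‖gradient g 0‖ * ‖v‖ ^ 2 :=
  abs_apply_self_le_sSup_mul _ hgrad hv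

theorem IsC2BoundaryFunction.hasQuadraticSupport {zbar : E n} {g : dirSpace C → ℝ}
    (h : IsC2BoundaryFunction C zbar g) {ε : ℝ} (hε : 0 < ε) :
    HasQuadraticSupport C zbar (curvature g / 2 + ε) := by
  obtain ⟨hzA, ⟨U, hUo, hU0, hgU, hU⟩, hgrad⟩ := h
  have hUnhds : U ∈ 𝓝 (0 : dirSpace C) := hUo.mem_nhds hU0
  have hg : ContDiffAt ℝ 2 g 0 := hgU.contDiffAt hUnhds
  have hκ := curvature_nonneg g
  set N := ‖gradient g 0‖⁻¹ • gradient g 0 with hN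
  have hN1 : ‖N‖ = 1 := by
    rw [hN, norm_smul, norm_inv, norm_norm, inv_mul_cancel₀ (norm_pos_iff.2 hgrad).ne']
  have hin : ∀ᶠ q : dirSpace C × dirSpace C in 𝓝 (0, 0),
      q.2 - ((curvature g / 2 + ε) * ‖q.2 - q.1‖ ^ 2) • N ∈ U := by
    have hc : Continuous fun q : dirSpace C × dirSpace C =>
        q.2 - ((curvature g / 2 + ε) * ‖q.2 - q.1‖ ^ 2) • N := by fun_prop
    have ht := hc.tendsto (0, 0)
    simp only [sub_self, norm_zero, ne_eq, OfNat.ofNat_ne_zero, not_false_eq_true, zero_pow,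
      mul_zero, zero_smul] at ht
    exact ht.eventually hUnhds
  have hfst : ∀ᶠ q : dirSpace C × dirSpace C in 𝓝 (0, 0), q.1 ∈ U :=
    continuousAt_fst.eventually hUnhds
  have hall := (eventually_sub_smul_gradient_nonpos hg hgrad hκ
    (fun v hv => abs_fderiv_fderiv_le_curvature hgrad hv) hε).and (hin.and hfst)
  obtain ⟨δ, hδ, hball⟩ := Metric.eventually_nhds_iff_ball.1 hall
  filter_upwards [Metric.ball_mem_nhds (zbar, zbar) hδ] with ⟨p, w⟩ hq hp hw u hu hu0 hn hk
  rw [← ball_prod_same, mem_prod, mem_ball_iff_norm, mem_ball_iff_norm] at hq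
  simp only at hp hw hn hk hq ⊢
  set p' : dirSpace C := ⟨p - zbar, AffineSubspace.vsub_mem_direction
    (subset_affineSpan ℝ C hp) hzA⟩ with hp'
  set w' : dirSpace C := ⟨w - zbar, AffineSubspace.vsub_mem_direction hw hzA⟩ with hw'
  have hwp : ((w' - p' : dirSpace C) : E n) = w - p := by
    simp only [hw', hp', AddSubgroupClass.coe_sub]; abel
  obtain ⟨hstep, hqU, hpU⟩ := hball (p', w') (by
    rw [← ball_prod_same, mem_prod, mem_ball_zero_iff, mem_ball_zero_iff]
    exact hq)
  have hgp : g p' ≤ 0 := (hU p' hpU).2.1 (by rw [hp']; simpa using hp)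
  have hdir : fderiv ℝ g p' (w' - p') ≤ 0 := by
    refine fderiv_nonpos_of_normal (u := (⟨u, hu⟩ : dirSpace C)) ?_ hgp
      (fun h0 => hu0 (congrArg Subtype.val h0)) ?_ ?_
    · exact (hgU.contDiffAt (hUo.mem_nhds hpU)).differentiableAt (by norm_num)
    · filter_upwards [hUo.mem_nhds hpU] with s hs hgs
      have := hn _ ((hU s hs).2.2 hgs)
      rw [Submodule.coe_inner]
      convert this using 2
      simp only [hp', AddSubgroupClass.coe_sub]; abel
    · rw [Submodule.coe_inner, hwp]; exact hk
  have hmem := (hU _ hqU).2.2 (hstep hgp hdir)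
  refine (infDist_le_norm_sub hmem w).trans (le_of_eq ?_)
  have e : w - (zbar + ((w' - ((curvature g / 2 + ε) * ‖w' - p'‖ ^ 2) • N : dirSpace C) : E n)) =
      ((curvature g / 2 + ε) * ‖w' - p'‖ ^ 2) • (N : E n) := by
    simp only [hw', AddSubgroupClass.coe_sub, Submodule.coe_smul]; abel
  have hNE : ‖(N : E n)‖ = 1 := hN1
  have hwpn : ‖w' - p'‖ = ‖w - p‖ := by rw [← hwp]; rfl
  rw [e, norm_smul, hNE, Real.norm_of_nonneg (by positivity), mul_one, hwpn]

end Curvature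

/-! ### Quadratic rate -/

section Rate

variable {n : ℕ} {X Y : Set (E n)}

theorem tendsto_of_norm_sub_le {f : E n → E n} {zbar : E n}
    (h : ∀ z, ‖f z - zbar‖ ≤ ‖z - zbar‖) : Tendsto f (𝓝 zbar) (𝓝 zbar) := by
  rw [tendsto_iff_norm_sub_tendsto_zero]
  refine squeeze_zero (fun _ => norm_nonneg _) h ?_
  exact tendsto_iff_norm_sub_tendsto_zero.1 tendsto_id

/-- Near a common point, one step squares the distance to `X ∩ Y` up to a constant: the new iterate
lies in half-spaces that support `X` and `Y` at points no farther from the nearest common point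
than the old iterate. -/
theorem eventually_infDist_step_le (hX : IsClosed X) (hXc : Convex ℝ X) (hY : IsClosed Y)
    (hYc : Convex ℝ Y) (haff : affineSpan ℝ X = affineSpan ℝ Y) {zbar : E n}
    (hzbar : zbar ∈ X ∩ Y) {ω K : ℝ} (hω : ErrorBound X Y zbar ω) (hK : 0 ≤ K)
    (hKX : HasQuadraticSupport X zbar K) (hKY : HasQuadraticSupport Y zbar K) :
    ∀ᶠ z in 𝓝 zbar,
      Metric.infDist (step X Y z) (X ∩ Y) ≤ 4 * K / ω * Metric.infDist z (X ∩ Y) ^ 2 := by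
  have hne : (X ∩ Y).Nonempty := ⟨zbar, hzbar⟩
  have hpX : ∀ s ∈ X ∩ Y, ∀ z, ‖proj X (centralize X Y z) - s‖ ≤ ‖z - s‖ := fun s hs z =>
    (norm_proj_sub_le hX hXc _ hs.1).trans (norm_centralize_sub_le hX hXc hY hYc z hs)
  have hpY : ∀ s ∈ X ∩ Y, ∀ z, ‖proj Y (centralize X Y z) - s‖ ≤ ‖z - s‖ := fun s hs z =>
    (norm_proj_sub_le hY hYc _ hs.2).trans (norm_centralize_sub_le hX hXc hY hYc z hs)
  have hpy : ∀ s ∈ X ∩ Y, ∀ z, ‖proj Y (proj X z) - s‖ ≤ ‖z - s‖ := fun s hs z =>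
    (norm_proj_sub_le hY hYc _ hs.2).trans (norm_proj_sub_le hX hXc z hs.1)
  have hT : Tendsto (step X Y) (𝓝 zbar) (𝓝 zbar) :=
    tendsto_of_norm_sub_le fun z => norm_step_sub_le hX hXc hY hYc z hzbar
  have lift : ∀ f : E n → E n, (∀ s ∈ X ∩ Y, ∀ z, ‖f z - s‖ ≤ ‖z - s‖) →
      Tendsto (fun z => (f z, step X Y z)) (𝓝 zbar) (𝓝 (zbar, zbar)) := fun f hf =>
    (tendsto_of_norm_sub_le (hf zbar hzbar)).prodMk_nhds hT
  filter_upwards [(lift _ hpX).eventually hKX, (lift _ hpY).eventually hKY,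
    (lift _ hpy).eventually hKY, hT.eventually hω.2] with z h1 h2 h3 hEB
  obtain ⟨hs, hsd⟩ := proj_mem (hX.inter hY) hne z
  set s := proj (X ∩ Y) z
  obtain ⟨hwX, hwY, -, hw0, -⟩ := step_spec hX hXc hY hYc hne z rfl rfl
  have hin := inner_centralize_le hX hXc hY hYc hne z
  have hwA := step_mem_affineSpan hX hXc hY hYc hne haff z
  have hcA := centralize_mem_affineSpan hX hY hne haff z
  have hws := norm_step_sub_le hX hXc hY hYc z hs
  have hpX' := hpX s hs z
  have hpY' := hpY s hs z
  have hpy' := hpy s hs z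
  have hcX := proj_centralize_left hX hXc hne.left (Y := Y) z
  have hcdef : centralize X Y z =
    (1 / 2 : ℝ) • (proj Y (proj X z) + proj X (proj Y (proj X z))) := rfl
  set c := centralize X Y z
  set w := step X Y z
  set D := Metric.infDist z (X ∩ Y)
  rw [dist_eq_norm] at hsd
  -- all points of support are within `2 D` of the new iterate
  have hfar : ∀ p : E n, ‖p - s‖ ≤ ‖z - s‖ → K * ‖w - p‖ ^ 2 ≤ 4 * K * D ^ 2 := by
    intro p hp
    have h := norm_sub_le_norm_sub_add_norm_sub w s p
    rw [norm_sub_rev s p] at h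
    have h' : ‖w - p‖ ≤ 2 * D := by linarith
    calc K * ‖w - p‖ ^ 2 ≤ K * (2 * D) ^ 2 := by gcongr
      _ = _ := by ring
  have hbound0 : 0 ≤ 4 * K * D ^ 2 := by positivity
  -- if `c ∈ X`, then `c ∈ Y` as well, and the new iterate is `c`
  have hcX0 : c - proj X c = 0 → c - proj Y c = 0 := by
    intro h
    rw [h, inner_zero_left] at hin
    have : ‖c - proj Y c‖ ^ 2 = 0 := le_antisymm (by linarith) (sq_nonneg _)
    exact norm_eq_zero.1 (pow_eq_zero_iff two_ne_zero |>.1 this)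
  have hdX : Metric.infDist w X ≤ 4 * K * D ^ 2 := by
    rcases eq_or_ne (c - proj X c) 0 with h0 | h0
    · rw [hw0 (hcX0 h0), Metric.infDist_zero_of_mem (proj_mem hX hne.left c).1]
      exact hbound0
    · have hp := (proj_mem hX hne.left c).1
      exact (h1 hp hwA _ (AffineSubspace.vsub_mem_direction hcA (subset_affineSpan ℝ X hp)) h0
        (fun t ht => inner_sub_proj_nonpos hX hXc c ht) hwX.le).trans (hfar _ hpX')
  have hdY : Metric.infDist w Y ≤ 4 * K * D ^ 2 := by
    have hy := (proj_mem hY hne.right (proj X z)).1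
    rcases eq_or_ne (c - proj Y c) 0 with h0 | h0
    · -- here `c ∈ Y` does not support `Y`; the half-space at `y = P_Y P_X z` takes over
      have hw : w = proj X (proj Y (proj X z)) := by rw [hw0 h0, hcX]
      rcases eq_or_ne (proj X z - proj Y (proj X z)) 0 with h4 | h4
      · have hyX : proj Y (proj X z) ∈ X := by
          rw [← sub_eq_zero.1 h4]; exact (proj_mem hX hne.left z).1
        have hfix : proj X (proj Y (proj X z)) = proj Y (proj X z) :=
          proj_eq_of_inner_nonpos hX hXc hyX fun t _ => by rw [sub_self, inner_zero_left]
        rw [hw, hfix, Metric.infDist_zero_of_mem hy]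
        exact hbound0
      · have hcY : c ∈ Y := by
          rw [sub_eq_zero.1 h0]; exact (proj_mem hY hne.right c).1
        have hcy := inner_sub_proj_nonpos hY hYc (proj X z) hcY
        have e : w - proj Y (proj X z) = (2 : ℝ) • (c - proj Y (proj X z)) := by
          rw [hw, hcdef]; module
        refine (h3 hy (haff ▸ hwA) _ (AffineSubspace.vsub_mem_direction ?_
          (subset_affineSpan ℝ Y hy)) h4 (fun t ht => inner_sub_proj_nonpos hY hYc _ ht) ?_).trans
          (hfar _ hpy')
        · rw [← haff]; exact subset_affineSpan ℝ X (proj_mem hX hne.left z).1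
        · rw [e, inner_smul_right]; exact mul_nonpos_of_nonneg_of_nonpos zero_le_two hcy
    · have hp := (proj_mem hY hne.right c).1
      exact (h2 hp (haff ▸ hwA) _ (AffineSubspace.vsub_mem_direction (haff ▸ hcA)
        (subset_affineSpan ℝ Y hp)) h0 (fun t ht => inner_sub_proj_nonpos hY hYc c ht)
        hwY.le).trans (hfar _ hpY')
  have := hEB.trans (max_le hdX hdY)
  rw [div_mul_eq_mul_div, le_div_iff₀ hω.1.1]
  linarith

/-- By Fejér monotonicity, the distance of an iterate to the limit is comparable to its distance to
`X ∩ Y`. -/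
theorem norm_sub_le_two_mul_infDist (hX : IsClosed X) (hXc : Convex ℝ X) (hY : IsClosed Y)
    (hYc : Convex ℝ Y) (hne : (X ∩ Y).Nonempty) {z : ℕ → E n}
    (hz : ∀ k, z (k + 1) = step X Y (z k)) {zbar : E n} (hlim : Tendsto z atTop (𝓝 zbar)) (k : ℕ) :
    ‖z k - zbar‖ ≤ 2 * Metric.infDist (z k) (X ∩ Y) := by
  obtain ⟨hs, hsd⟩ := proj_mem (hX.inter hY) hne (z k)
  set s := proj (X ∩ Y) (z k)
  have hanti : Antitone fun m => ‖z m - s‖ := antitone_nat_of_succ_le fun m => by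
    rw [hz m]; exact norm_step_sub_le hX hXc hY hYc (z m) hs
  have h1 : ‖zbar - s‖ ≤ ‖z k - s‖ :=
    le_of_tendsto (hlim.sub_const s).norm (eventually_atTop.2 ⟨k, fun m hm => hanti hm⟩)
  rw [dist_eq_norm] at hsd
  have h2 := norm_sub_le_norm_sub_add_norm_sub (z k) s zbar
  rw [norm_sub_rev s zbar] at h2
  linarith

/-- Passage from a real estimate `a ≤ K b²` to quotients in `[0, ∞]`. -/
theorem ofReal_div_sq_le {a b K : ℝ} (hb : 0 ≤ b) (hK : 0 ≤ K) (h : a ≤ K * b ^ 2) :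
    ENNReal.ofReal a / ENNReal.ofReal b ^ 2 ≤ ENNReal.ofReal K := by
  refine ENNReal.div_le_of_le_mul ?_
  rw [← ENNReal.ofReal_pow hb, ← ENNReal.ofReal_mul hK]
  exact ENNReal.ofReal_le_ofReal h

theorem infEDist_eq_ofReal_infDist {C : Set (E n)} (hC : C.Nonempty) (x : E n) :
    Metric.infEDist x C = ENNReal.ofReal (Metric.infDist x C) :=
  (ENNReal.ofReal_toReal (Metric.infEDist_ne_top hC)).symm

end Rate

end CCRM

theorem mainTheorem1 {n : ℕ} (X Y : Set (EuclideanSpace ℝ (Fin n)))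
    (hXclosed : IsClosed X) (hXconv : Convex ℝ X)
    (hYclosed : IsClosed Y) (hYconv : Convex ℝ Y)
    (hXY : (X ∩ Y).Nonempty)
    (haff : affineSpan ℝ X = affineSpan ℝ Y)
    (hri : (intrinsicInterior ℝ X ∩ intrinsicInterior ℝ Y).Nonempty)
    (z : ℕ → EuclideanSpace ℝ (Fin n))
    (hz : ∀ k, z (k + 1) = CCRM.step X Y (z k)) :
    ∃ zbar ∈ X ∩ Y, Tendsto z atTop (𝓝 zbar) ∧
      (∃ ω, CCRM.ErrorBound X Y zbar ω) ∧
      ∀ (gX : CCRM.dirSpace X → ℝ) (gY : CCRM.dirSpace Y → ℝ),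
        CCRM.IsC2BoundaryFunction X zbar gX → CCRM.IsC2BoundaryFunction Y zbar gY →
          CCRM.QQuadratic z zbar ∧
          ∀ ω, CCRM.ErrorBound X Y zbar ω →
            limsup (fun k => Metric.infEDist (z (k + 1)) (X ∩ Y) /
                Metric.infEDist (z k) (X ∩ Y) ^ 2) atTop
              ≤ ENNReal.ofReal (4 * max (CCRM.curvature gX) (CCRM.curvature gY) / ω) := by
  obtain ⟨zbar, hzbar, hlim⟩ :=
    CCRM.exists_tendsto_of_step hXclosed hXconv hYclosed hYconv hXY hz
  have hEB := CCRM.exists_errorBound hXclosed hXconv hYclosed hYconv haff hri hzbar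
  refine ⟨zbar, hzbar, hlim, hEB, fun gX gY hgX hgY => ?_⟩
  set κ := max (CCRM.curvature gX) (CCRM.curvature gY) with hκ
  have hκ0 : 0 ≤ κ := le_max_of_le_left (CCRM.curvature_nonneg gX)
  have hκX : CCRM.curvature gX ≤ κ := le_max_left _ _
  have hκY : CCRM.curvature gY ≤ κ := le_max_right _ _
  have rate : ∀ ω, CCRM.ErrorBound X Y zbar ω → ∀ ε > 0, ∀ᶠ k in atTop,
      Metric.infDist (z (k + 1)) (X ∩ Y) ≤
        4 * (κ / 2 + ε) / ω * Metric.infDist (z k) (X ∩ Y) ^ 2 := by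
    intro ω hω ε hε
    have h := hlim.eventually (CCRM.eventually_infDist_step_le hXclosed hXconv hYclosed hYconv haff
      hzbar hω (K := κ / 2 + ε) (by positivity)
      ((hgX.hasQuadraticSupport hε).mono (by linarith))
      ((hgY.hasQuadraticSupport hε).mono (by linarith)))
    filter_upwards [h] with k hk
    rwa [hz k]
  constructor
  · obtain ⟨ω, hω⟩ := hEB
    have hω0 := hω.1.1
    refine ⟨hlim, (2 * (4 * (κ / 2 + 1) / ω)).toNNReal, ?_⟩
    refine limsup_le_of_le (by isBoundedDefault) ?_
    filter_upwards [rate ω hω 1 one_pos] with k hk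
    rw [edist_dist, edist_dist]
    refine CCRM.ofReal_div_sq_le dist_nonneg (by positivity) ?_
    have h1 := CCRM.norm_sub_le_two_mul_infDist hXclosed hXconv hYclosed hYconv hXY hz hlim (k + 1)
    have h2 : Metric.infDist (z k) (X ∩ Y) ≤ dist (z k) zbar :=
      Metric.infDist_le_dist_of_mem hzbar
    have h3 := pow_le_pow_left₀ Metric.infDist_nonneg h2 2
    have h4 := mul_le_mul_of_nonneg_left h3 (show 0 ≤ 4 * (κ / 2 + 1) / ω by positivity)
    rw [dist_eq_norm (z (k + 1))]
    linarith
  · intro ω hω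
    have hω0 := hω.1.1
    refine ENNReal.le_of_forall_pos_le_add fun η hη _ => ?_
    have hη' : (0 : ℝ) < η := hη
    refine limsup_le_of_le (by isBoundedDefault) ?_
    -- `ω η / 4` turns the constant `4 (κ / 2 + ε) / ω` into `2 κ / ω + η`
    filter_upwards [rate ω hω (ω * η / 4) (by positivity)] with k hk
    rw [CCRM.infEDist_eq_ofReal_infDist hXY, CCRM.infEDist_eq_ofReal_infDist hXY,
      ← ENNReal.ofReal_coe_nnreal, ← ENNReal.ofReal_add (by positivity) hη'.le]
    refine (CCRM.ofReal_div_sq_le Metric.infDist_nonneg (by positivity) hk).trans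
      (ENNReal.ofReal_le_ofReal ?_)
    have e : 4 * (κ / 2 + ω * η / 4) / ω = 2 * κ / ω + η := by field_simp; ring
    have h5 : 2 * κ / ω ≤ 4 * κ / ω := div_le_div_of_nonneg_right (by linarith) hω0.le
    linarith
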